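/- Let $n\ge 1$, $t_c>0$, and let $x_1,\dots,x_n,m_1,\dots,m_n:[0,t_c)\to\mathbb R$ be continuous functions with $x_1(0)<x_2(0)<\dots<x_n(0)$ (the masses $m_i$ may have either sign) that satisfy on $(0,t_c)$ the Degasperis–Procesi multipeakon equations $$\dot x_k=\sum_{i=1}^n m_i\,e^{-|x_k-x_i|},\qquad \dot m_k=2m_k\sum_{i=1}^n m_i\,\operatorname{sgn}(x_k-x_i)\,e^{-|x_k-x_i|}\qquad(1\le k\le n).$$ Say that $m_i$ blows up at $t_c$ if it is unbounded on every left neighbourhood of $t_c$, that peakons $i$ and $j$ collide at $t_c$ if $\lim_{t\to t_c^-}x_i(t)$ and $\lim_{t\to t_c^-}x_j(t)$ exist in $\mathbb R$ and are equal, and that $t_c$ is a collision time if peakons $i$ and $i+1$ collide at $t_c$ for some $i$ with $1\le i<n$. Suppose that $m_{j_1},\dots,m_{j_k}$, where $k\ge 1$ and $1\le j_1<\dots<j_k\le n$, blow up at $t_c$, and that all other $m_i$ remain bounded on $[0,t_c)$. Then: 1. $k$ is even. 2. $t_c$ is a collision time; moreover, for every odd $l$ with $1\le l<k$, peakon $j_l$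 collides with peakon $j_{l+1}$ at $t_c$. 3. For every $1\le s\le k$, the function $m_{j_s}$ coincides to the left of $t_c$ with a function meromorphic at $t_c$ whose Laurent series around $t_c$ has leading term $\dfrac{(-1)^s}{2(t-t_c)}$. -/

import Mathlib

open Filter Topology

/-- `(x, m)` is a solution on `[0, tc)` of the Degasperis–Procesi `n`-peakon equations
`x_k' = ∑ i, m_i e^{-|x_k - x_i|}` and
`m_k' = 2 m_k ∑ i, m_i sgn(x_k - x_i) e^{-|x_k - x_i|}`,
with ordered initial positions `x_1(0) < ⋯ < x_n(0)`. The masses may have either sign. -/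
structure IsMultipeakon {n : ℕ} (x m : Fin n → ℝ → ℝ) (tc : ℝ) : Prop where
  initial_order : StrictMono fun k => x k 0
  continuousOn_position : ∀ k, ContinuousOn (x k) (Set.Ico 0 tc)
  continuousOn_mass : ∀ k, ContinuousOn (m k) (Set.Ico 0 tc)
  deriv_position : ∀ k, ∀ t ∈ Set.Ioo 0 tc,
    HasDerivAt (x k) (∑ i, m i t * Real.exp (-|x k t - x i t|)) t
  deriv_mass : ∀ k, ∀ t ∈ Set.Ioo 0 tc,
    HasDerivAt (m k)
      (2 * m k t * ∑ i, m i t * Real.sign (x k t - x i t) * Real.exp (-|x k t - x i t|)) t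

/-- `f` stays bounded on `[0, tc)`. -/
def RemainsBounded (f : ℝ → ℝ) (tc : ℝ) : Prop :=
  ∃ C : ℝ, ∀ t ∈ Set.Ico 0 tc, |f t| ≤ C

/-- `f` blows up at `tc`: it is unbounded on every left neighbourhood of `tc`. -/
def BlowsUpAt (f : ℝ → ℝ) (tc : ℝ) : Prop :=
  ∀ C : ℝ, ∃ᶠ t in 𝓝[<] tc, C < |f t|

/-- Peakons `i` and `j` collide at `tc`: their positions have the same (finite) limit
as `t → tc` from the left. -/
def Collide {n : ℕ} (x : Fin n → ℝ → ℝ) (i j : Fin n) (tc : ℝ) : Prop :=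
  ∃ xc : ℝ, Tendsto (x i) (𝓝[<] tc) (𝓝 xc) ∧ Tendsto (x j) (𝓝[<] tc) (𝓝 xc)

/-- `tc` is a collision time: some two neighbouring peakons collide at `tc`. -/
def IsCollisionTime {n : ℕ} (x : Fin n → ℝ → ℝ) (tc : ℝ) : Prop :=
  ∃ (i : ℕ) (hi : i + 1 < n), Collide x ⟨i, by omega⟩ ⟨i + 1, hi⟩ tc

/-- To the left of `tc`, `f` is the restriction of a function meromorphic at `tc` whose
Laurent series around `tc` has the leading term `a * (t - tc) ^ p` (with `a ≠ 0`). -/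
def HasLaurentLeadingTerm (f : ℝ → ℝ) (tc a : ℝ) (p : ℤ) : Prop :=
  a ≠ 0 ∧ ∃ g : ℝ → ℝ, AnalyticAt ℝ g tc ∧ g tc = a ∧
    ∀ᶠ t in 𝓝[<] tc, f t = (t - tc) ^ p * g t

/-!
The positions are determined by `y k = e^{x k}`, and the proof has two halves: the functions `y k`
and the masses are meromorphic at `tc`, and meromorphic solutions have only one possible behaviour.

*Meromorphy.* Peakons of zero mass do not influence the others, and a mass that is nonzero at one
time is nonzero always, so all masses may be assumed nonzero. The Degasperis–Procesi equation has
the Lax pair `ψ' - ψ''' = z (u - u'') ψ`, `ψ_t = z⁻¹ (1 - ∂²) ψ + u' ψ - u ψ'`. Between two peakons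
the solution that equals `eˣ` far to the left has the form `a(z) eˣ + b(z) + c(z) e⁻ˣ` with
polynomials `a`, `b`, `c` in `z`, and each peakon acts on `(a, b, c)` by an elementary jump. To the
right of all peakons (`IsExpPeakon.hasDerivAt_wave_last`), `a` is conserved, the coefficients of `b`
solve a linear equation with constant coefficients, and the derivative of `c` is quadratic in `b`;
hence all coefficients extend analytically past `tc`. Conversely the leading coefficients of
`(a, b, c)` to the right of a peakon are in the ratio `1 / y : -2 : y`, so the position of the last
peakon, its mass, and the wave function to its left are rational functions of the coefficients, and
one proceeds inductively to the left (`IsExpPeakon.isLeftMeromorphicAt_step`). Moreover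
`y = -b / (2 a)` at the last peakon, where the leading coefficient of `a` is a nonzero constant; so
the last position is bounded from above, and by reflection symmetry the first one is bounded from
below. Therefore all positions converge.

*Local analysis* (`IsExpPeakon.exists_gap_orders`). Between the peakons `k - 1` and `k` the velocity
field is `P k eˣ + Q k e⁻ˣ`, and `y k - y (k - 1)` has logarithmic derivative
`P k (y k + y (k - 1))`. If `q k` is the order of vanishing of this gap at `tc`, then `P k y k` has
the residue `q k / 2`. Since `μ k / y k = P k - P (k + 1)`, the mass `μ k` has at most a simple
pole, with residue `(q k - q (k + 1)) / 2`. On the other hand its logarithmic derivative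
`2 (Q k / y k - P (k + 1) y k)` has residue `-(q k + q (k + 1))`, which is thus the order of `μ k`.
So `q k + q (k + 1) ≤ 1`: a mass blows up exactly if one of the two neighbouring gaps closes, the
gap closes to first order, and the blow-ups come in disjoint pairs of neighbours with residues
`-1/2` and `1/2`.
-/

/-! ### Growth estimates and linear equations -/

/-- Two-sided Grönwall estimate for `|f'| ≤ K |f|`: the functions `f² e^{2Kt}` and `f² e^{-2Kt}`
are monotone and antitone. -/
theorem sq_bounds_of_abs_deriv_le {f f' : ℝ → ℝ} {K T : ℝ} (hT : 0 ≤ T)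
    (hf : ContinuousOn f (Set.Icc 0 T)) (hf' : ∀ t ∈ Set.Ioo 0 T, HasDerivAt f (f' t) t)
    (hK : ∀ t ∈ Set.Ioo 0 T, |f' t| ≤ K * |f t|) :
    f 0 ^ 2 ≤ f T ^ 2 * Real.exp (2 * K * T) ∧ f T ^ 2 ≤ f 0 ^ 2 * Real.exp (2 * K * T) := by
  have key : ∀ t ∈ Set.Ioo 0 T, |f t * f' t| ≤ K * f t ^ 2 := by
    intro t ht
    rw [abs_mul, ← sq_abs (f t)]
    nlinarith [hK t ht, abs_nonneg (f t)]
  have hder : ∀ (c t : ℝ), t ∈ Set.Ioo 0 T →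
      HasDerivAt (fun t => f t ^ 2 * Real.exp (c * t))
        ((2 * (f t * f' t) + c * f t ^ 2) * Real.exp (c * t)) t := by
    intro c t ht
    have h1 := ((hf' t ht).pow 2).mul (((hasDerivAt_id t).const_mul c).exp)
    refine h1.congr_deriv ?_
    simp only [id, Nat.cast_ofNat, Pi.pow_apply]
    ring
  have hcont : ∀ c : ℝ, ContinuousOn (fun t => f t ^ 2 * Real.exp (c * t)) (Set.Icc 0 T) :=
    fun c => (hf.pow 2).mul (by fun_prop)
  have h0 : (0 : ℝ) ∈ Set.Icc 0 T := ⟨le_rfl, hT⟩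
  have h1 : T ∈ Set.Icc 0 T := ⟨hT, le_rfl⟩
  have hmono : MonotoneOn (fun t => f t ^ 2 * Real.exp (2 * K * t)) (Set.Icc 0 T) := by
    refine monotoneOn_of_deriv_nonneg (convex_Icc 0 T) (hcont _) ?_ ?_ <;> rw [interior_Icc]
    · exact fun t ht => (hder _ t ht).differentiableAt.differentiableWithinAt
    · intro t ht
      rw [(hder _ t ht).deriv]
      have := (abs_le.1 (key t ht)).1
      exact mul_nonneg (by linarith) (Real.exp_pos _).le
  have hanti : AntitoneOn (fun t => f t ^ 2 * Real.exp (-(2 * K) * t)) (Set.Icc 0 T) := by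
    refine antitoneOn_of_deriv_nonpos (convex_Icc 0 T) (hcont _) ?_ ?_ <;> rw [interior_Icc]
    · exact fun t ht => (hder _ t ht).differentiableAt.differentiableWithinAt
    · intro t ht
      rw [(hder _ t ht).deriv]
      have := (abs_le.1 (key t ht)).2
      exact mul_nonpos_of_nonpos_of_nonneg (by linarith) (Real.exp_pos _).le
  constructor
  · simpa using hmono h0 h1 hT
  · have h2 := hanti h0 h1 hT
    simp only [mul_zero, Real.exp_zero, mul_one] at h2
    have h3 := mul_le_mul_of_nonneg_right h2 (Real.exp_pos (2 * K * T)).le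
    rwa [mul_assoc, ← Real.exp_add, show -(2 * K) * T + 2 * K * T = 0 by ring, Real.exp_zero,
      mul_one] at h3

/-- A solution of an autonomous linear equation on `(0, tc)` is the restriction of a function
analytic at `tc`, namely of `t ↦ exp ((t - t₀) L) v(t₀)`. -/
theorem exists_analyticAt_of_linear_ode {E : Type*} [NormedAddCommGroup E] [NormedSpace ℝ E]
    [CompleteSpace E] (L : E →L[ℝ] E) {v : ℝ → E} {tc : ℝ} (htc : 0 < tc)
    (hv : ∀ t ∈ Set.Ioo 0 tc, HasDerivAt v (L (v t)) t) :
    ∃ w : ℝ → E, AnalyticAt ℝ w tc ∧ ∀ t ∈ Set.Ioo 0 tc, v t = w t := by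
  set t₀ := tc / 2
  have ht₀ : t₀ ∈ Set.Ioo 0 tc := ⟨by positivity, half_lt_self htc⟩
  set w : ℝ → E := fun t => NormedSpace.exp ((t - t₀) • L) (v t₀)
  have hw : ∀ t, HasDerivAt w (L (w t)) t := by
    intro t
    have h1 : HasDerivAt (fun u : ℝ => NormedSpace.exp (u • L))
        (L * NormedSpace.exp ((t - t₀) • L)) (t - t₀) := hasDerivAt_exp_smul_const' L _
    have h2 := h1.comp_sub_const t t₀
    exact (h2.clm_apply (hasDerivAt_const t (v t₀))).congr_deriv (by simp [w])
  refine ⟨w, ?_, ?_⟩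
  · have h1 : AnalyticAt ℝ (fun A : E →L[ℝ] E => NormedSpace.exp A) ((tc - t₀) • L) :=
      NormedSpace.exp_analytic _
    have h2 : AnalyticAt ℝ (fun t : ℝ => (t - t₀) • L) tc := by fun_prop
    have h3 : AnalyticAt ℝ (fun t : ℝ => NormedSpace.exp ((t - t₀) • L)) tc :=
      AnalyticAt.fun_comp h1 h2
    exact (ContinuousLinearMap.analyticAt (ContinuousLinearMap.apply ℝ E (v t₀)) _).fun_comp h3
  · refine ODE_solution_unique_of_mem_Ioo (v := fun _ => L) (s := fun _ => Set.univ)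
      (K := ‖L‖₊) (fun t _ => L.lipschitz.lipschitzOnWith) ht₀
      (fun t ht => ⟨hv t ht, trivial⟩) (fun t _ => ⟨hw t, trivial⟩) ?_
    simp [w]

/-! ### Elementary properties of multipeakons -/

namespace IsMultipeakon

variable {n : ℕ} {x m : Fin n → ℝ → ℝ} {tc : ℝ}

theorem exists_abs_mass_le (h : IsMultipeakon x m tc) {T : ℝ} (hT : T ∈ Set.Ico 0 tc) :
    ∃ K, 0 ≤ K ∧ ∀ t ∈ Set.Icc 0 T, ∑ i, |m i t| ≤ K := by
  have hc : ContinuousOn (fun t => ∑ i, |m i t|) (Set.Icc 0 T) :=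
    continuousOn_finsetSum _ fun i _ =>
      ((h.continuousOn_mass i).mono (Set.Icc_subset_Ico_right hT.2)).abs
  obtain ⟨K, hK⟩ := isCompact_Icc.exists_bound_of_continuousOn hc
  refine ⟨K, (norm_nonneg _).trans (hK 0 ⟨le_rfl, hT.1⟩), fun t ht => ?_⟩
  exact (le_abs_self _).trans (hK t ht)

theorem position_ne (h : IsMultipeakon x m tc) {i j : Fin n} (hij : i < j) {T : ℝ}
    (hT : T ∈ Set.Ico 0 tc) : x j T - x i T ≠ 0 := by
  obtain ⟨K, hK0, hK⟩ := h.exists_abs_mass_le hT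
  have hsub : Set.Icc 0 T ⊆ Set.Ico 0 tc := Set.Icc_subset_Ico_right hT.2
  have key := sq_bounds_of_abs_deriv_le (K := K) (f := fun t => x j t - x i t)
    (f' := fun t => ∑ l, m l t * Real.exp (-|x j t - x l t|) -
      ∑ l, m l t * Real.exp (-|x i t - x l t|)) hT.1
    (((h.continuousOn_position j).mono hsub).sub ((h.continuousOn_position i).mono hsub))
    (fun t ht => (h.deriv_position j t (Set.Ioo_subset_Ioo_right hT.2.le ht)).sub
      (h.deriv_position i t (Set.Ioo_subset_Ioo_right hT.2.le ht))) ?_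
  · intro h0
    have h1 := key.1
    simp only [h0] at h1
    have h2 : 0 < x j 0 - x i 0 := sub_pos.2 (h.initial_order hij)
    nlinarith
  · intro t ht
    -- `r ↦ exp (-|r|)` is 1-Lipschitz
    have hlip : ∀ a b : ℝ, |Real.exp (-|a|) - Real.exp (-|b|)| ≤ |a - b| := by
      have hle : ∀ a b : ℝ, Real.exp (-|a|) - Real.exp (-|b|) ≤ |a - b| := by
        intro a b
        have h1 : 1 - (|b| - |a|) ≤ Real.exp (-(|b| - |a|)) := Real.one_sub_le_exp_neg _
        have h2 : Real.exp (-|b|) = Real.exp (-|a|) * Real.exp (-(|b| - |a|)) := by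
          rw [← Real.exp_add]; ring_nf
        have h3 : Real.exp (-|a|) ≤ 1 := Real.exp_le_one_iff.2 (neg_nonpos.2 (abs_nonneg a))
        have h4 : |b| - |a| ≤ |a - b| := by rw [abs_sub_comm]; exact abs_sub_abs_le_abs_sub b a
        have h5 := Real.exp_pos (-|a|)
        rw [h2]
        nlinarith [abs_nonneg (a - b)]
      intro a b
      refine abs_le.2 ⟨?_, hle a b⟩
      have := hle b a
      rw [abs_sub_comm] at this
      linarith
    rw [← Finset.sum_sub_distrib]
    calc _ ≤ ∑ l, |m l t * Real.exp (-|x j t - x l t|) - m l t * Real.exp (-|x i t - x l t|)| :=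
          Finset.abs_sum_le_sum_abs _ _
      _ ≤ ∑ l, |m l t| * |x j t - x i t| := by
          refine Finset.sum_le_sum fun l _ => ?_
          rw [← mul_sub, abs_mul]
          refine mul_le_mul_of_nonneg_left ((hlip _ _).trans_eq ?_) (abs_nonneg _)
          congr 1; ring
      _ ≤ K * |x j t - x i t| := by
          rw [← Finset.sum_mul]
          exact mul_le_mul_of_nonneg_right (hK t ⟨ht.1.le, ht.2.le⟩) (abs_nonneg _)

theorem strictMono_position (h : IsMultipeakon x m tc) {T : ℝ} (hT : T ∈ Set.Ico 0 tc) :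
    StrictMono fun i => x i T := by
  intro i j hij
  by_contra! hle
  have hsub : Set.Icc 0 T ⊆ Set.Ico 0 tc := Set.Icc_subset_Ico_right hT.2
  have hc : ContinuousOn (fun t => x j t - x i t) (Set.Icc 0 T) :=
    ((h.continuousOn_position j).mono hsub).sub ((h.continuousOn_position i).mono hsub)
  have h0 : 0 < x j 0 - x i 0 := sub_pos.2 (h.initial_order hij)
  obtain ⟨t, ht, ht0⟩ := intermediate_value_Icc' hT.1 hc ⟨sub_nonpos.2 hle, h0.le⟩
  exact h.position_ne hij (hsub ht) ht0

/-- A mass either vanishes identically or has no zero. -/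
theorem mass_eq_zero_iff (h : IsMultipeakon x m tc) (i : Fin n) {T : ℝ}
    (hT : T ∈ Set.Ico 0 tc) : m i T = 0 ↔ m i 0 = 0 := by
  obtain ⟨K, hK0, hK⟩ := h.exists_abs_mass_le hT
  have hsub : Set.Icc 0 T ⊆ Set.Ico 0 tc := Set.Icc_subset_Ico_right hT.2
  have key := sq_bounds_of_abs_deriv_le (K := 2 * K) hT.1
    ((h.continuousOn_mass i).mono hsub)
    (fun t ht => h.deriv_mass i t (Set.Ioo_subset_Ioo_right hT.2.le ht)) ?_
  · constructor <;> intro h0 <;> simp only [h0] at key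
    · exact pow_eq_zero_iff two_ne_zero |>.1 (le_antisymm (by simpa using key.1) (sq_nonneg _))
    · exact pow_eq_zero_iff two_ne_zero |>.1 (le_antisymm (by simpa using key.2) (sq_nonneg _))
  · intro t ht
    have h1 : |∑ l, m l t * Real.sign (x i t - x l t) * Real.exp (-|x i t - x l t|)| ≤ K := by
      refine (Finset.abs_sum_le_sum_abs _ _).trans
        ((Finset.sum_le_sum fun l _ => ?_).trans (hK t ⟨ht.1.le, ht.2.le⟩))
      rw [abs_mul, abs_mul, Real.abs_exp]
      have h3 : Real.exp (-|x i t - x l t|) ≤ 1 :=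
        Real.exp_le_one_iff.2 (neg_nonpos.2 (abs_nonneg _))
      have h4 : |Real.sign (x i t - x l t)| ≤ 1 := by
        rcases Real.sign_apply_eq (x i t - x l t) with h | h | h <;> simp [h]
      calc _ ≤ |m l t| * 1 * 1 := by gcongr
        _ = |m l t| := by ring
    rw [abs_mul, abs_mul, abs_two]
    nlinarith [abs_nonneg (m i t)]

/-- Peakons of zero mass do not influence the others, so they may be left out. -/
theorem comp_of_eq_zero (h : IsMultipeakon x m tc) {N : ℕ} {σ : Fin N → Fin n}
    (hσ : StrictMono σ) (h0 : ∀ i, i ∉ Set.range σ → ∀ t ∈ Set.Ioo 0 tc, m i t = 0) :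
    IsMultipeakon (fun i => x (σ i)) (fun i => m (σ i)) tc := by
  have hsum : ∀ F : Fin n → ℝ, (∀ i, i ∉ Set.range σ → F i = 0) → ∑ i, F i = ∑ i, F (σ i) :=
    fun F hF => (Fintype.sum_of_injective σ hσ.injective _ _ hF (fun _ => rfl)).symm
  refine ⟨h.initial_order.comp hσ, fun i => h.continuousOn_position _,
    fun i => h.continuousOn_mass _, fun i t ht => ?_, fun i t ht => ?_⟩
  · rw [← hsum (fun l => m l t * Real.exp (-|x (σ i) t - x l t|))
      (fun l hl => by simp [h0 l hl t ht])]
    exact h.deriv_position _ t ht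
  · rw [← hsum (fun l => m l t * Real.sign (x (σ i) t - x l t) * Real.exp (-|x (σ i) t - x l t|))
      (fun l hl => by simp [h0 l hl t ht])]
    exact h.deriv_mass _ t ht

/-- The equations are invariant under reflection of the line. -/
theorem reflect (h : IsMultipeakon x m tc) :
    IsMultipeakon (fun i t => -x i.rev t) (fun i t => -m i.rev t) tc := by
  refine ⟨fun i j hij => neg_lt_neg (h.initial_order (Fin.rev_lt_rev.2 hij)),
    fun i => (h.continuousOn_position _).neg, fun i => (h.continuousOn_mass _).neg,
    fun i t ht => ?_, fun i t ht => ?_⟩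
  · refine (h.deriv_position i.rev t ht).neg.congr_deriv ?_
    rw [← Finset.sum_neg_distrib, ← Equiv.sum_comp Fin.revPerm]
    refine Finset.sum_congr rfl fun l _ => ?_
    rw [Fin.revPerm_apply, neg_sub_neg, abs_sub_comm, neg_mul]
  · refine (h.deriv_mass i.rev t ht).neg.congr_deriv ?_
    rw [← Equiv.sum_comp Fin.revPerm, ← neg_mul, ← mul_neg]
    congr 1
    refine Finset.sum_congr rfl fun l _ => ?_
    rw [Fin.revPerm_apply, neg_sub_neg, abs_sub_comm, ← neg_sub (x i.rev t), Real.sign_neg]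
    ring

end IsMultipeakon

/-! ### The wave function and its evolution -/

/-- The coefficient sequences (in powers of the spectral parameter `z`) of a wave function
`a(z) eˣ + b(z) + c(z) e⁻ˣ`, a solution of `ψ' - ψ''' = 0` on an interval without peakons. -/
structure WaveCoeff where
  a : ℕ → ℝ
  b : ℕ → ℝ
  c : ℕ → ℝ

namespace WaveCoeff

/-- The coefficients in `z` of the value of the wave function at the point `log y`. -/
noncomputable def value (y : ℝ) (w : WaveCoeff) (p : ℕ) : ℝ := y * w.a p + w.b p + y⁻¹ * w.c p

/-- The wave function to the right of a peakon of mass `μ` at `log y`, in terms of the wave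
function to the left: it and its first derivative are continuous, while its second derivative
jumps by `-2 μ z` times its value. -/
noncomputable def jump (y μ : ℝ) (w : WaveCoeff) : WaveCoeff where
  a | 0 => w.a 0
    | p + 1 => w.a (p + 1) - μ * y⁻¹ * w.value y p
  b | 0 => w.b 0
    | p + 1 => w.b (p + 1) + 2 * μ * w.value y p
  c | 0 => w.c 0
    | p + 1 => w.c (p + 1) - μ * y * w.value y p

theorem value_jump {y : ℝ} (hy : y ≠ 0) (μ : ℝ) (w : WaveCoeff) (p : ℕ) :
    (w.jump y μ).value y p = w.value y p := by
  cases p with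
  | zero => rfl
  | succ p =>
    change y * (w.a (p + 1) - μ * y⁻¹ * w.value y p) + (w.b (p + 1) + 2 * μ * w.value y p)
      + y⁻¹ * (w.c (p + 1) - μ * y * w.value y p) = w.value y (p + 1)
    rw [show w.value y (p + 1) = y * w.a (p + 1) + w.b (p + 1) + y⁻¹ * w.c (p + 1) from rfl]
    field_simp
    ring

end WaveCoeff

/-- The wave function that equals `eˣ` to the left of all peakons, between the `k` leftmost
peakons and the others. The peakon with index `i` has mass `μ i` and position `log (y i)`. -/
noncomputable def wave (y μ : ℕ → ℝ) : ℕ → WaveCoeff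
  | 0 => ⟨Pi.single 0 1, 0, 0⟩
  | k + 1 => (wave y μ k).jump (y k) (μ k)

/-- `∑ μ i e^{-x i}` over the peakons that are not among the `k` leftmost ones: the coefficient
of `eˣ` in the velocity field. -/
noncomputable def rightMoment (N : ℕ) (y μ : ℕ → ℝ) (k : ℕ) : ℝ := ∑ i ∈ Finset.Ico k N, μ i / y i

/-- `∑ μ i e^{x i}` over the `k` leftmost peakons: the coefficient of `e⁻ˣ` in the velocity
field. -/
noncomputable def leftMoment (y μ : ℕ → ℝ) (k : ℕ) : ℝ := ∑ i ∈ Finset.range k, μ i * y i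

section wave

variable {y μ : ℕ → ℝ}

theorem wave_zero_coeff (k : ℕ) :
    (wave y μ k).a 0 = 1 ∧ (wave y μ k).b 0 = 0 ∧ (wave y μ k).c 0 = 0 := by
  induction k with
  | zero => simp [wave]
  | succ k ih => exact ih

theorem wave_b_one (k : ℕ) : (wave y μ k).b 1 = 2 * leftMoment y μ k := by
  induction k with
  | zero => simp [wave, leftMoment]
  | succ k ih =>
    obtain ⟨h1, h2, h3⟩ := wave_zero_coeff (y := y) (μ := μ) k
    change (wave y μ k).b 1 + 2 * μ k * (wave y μ k).value (y k) 0 = _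
    rw [ih, WaveCoeff.value, h1, h2, h3, leftMoment, leftMoment, Finset.sum_range_succ]
    ring

theorem wave_coeff_of_lt (k : ℕ) : ∀ p, k < p →
    (wave y μ k).a p = 0 ∧ (wave y μ k).b p = 0 ∧ (wave y μ k).c p = 0 := by
  induction k with
  | zero => intro p hp; simp [wave, hp.ne']
  | succ k ih =>
    intro p hp
    obtain ⟨p, rfl⟩ : ∃ q, p = q + 1 := ⟨p - 1, by omega⟩
    obtain ⟨h1, h2, h3⟩ := ih p (by omega)
    obtain ⟨h4, h5, h6⟩ := ih (p + 1) (by omega)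
    simp [wave, WaveCoeff.jump, WaveCoeff.value, *]

/-- The leading coefficients of the wave function to the right of the peakon `k` are in the ratio
`1 / y : -2 : y`. -/
theorem wave_top_coeff (k : ℕ) :
    (wave y μ (k + 1)).a (k + 1) = -(μ k * (y k)⁻¹ * (wave y μ k).value (y k) k) ∧
    (wave y μ (k + 1)).b (k + 1) = 2 * μ k * (wave y μ k).value (y k) k ∧
    (wave y μ (k + 1)).c (k + 1) = -(μ k * y k * (wave y μ k).value (y k) k) := by
  obtain ⟨h1, h2, h3⟩ := wave_coeff_of_lt (y := y) (μ := μ) k (k + 1) (by omega)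
  simp [wave, WaveCoeff.jump, h1, h2, h3]

theorem wave_value_top_ne_zero {N : ℕ} (hy : ∀ k < N, 0 < y k)
    (hlt : ∀ k, k + 1 < N → y k < y (k + 1)) (hμ : ∀ k < N, μ k ≠ 0) :
    ∀ k < N, (wave y μ k).value (y k) k ≠ 0 := by
  intro k
  induction k with
  | zero => intro hk; simpa [wave, WaveCoeff.value] using (hy 0 hk).ne'
  | succ k ih =>
    intro hk
    obtain ⟨h1, h2, h3⟩ := wave_top_coeff (y := y) (μ := μ) k
    have hk' : k < N := by omega
    have hy0 := (hy k hk').ne'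
    have hy1 := (hy (k + 1) hk).ne'
    have h4 : (wave y μ (k + 1)).value (y (k + 1)) (k + 1) =
        -(μ k * (wave y μ k).value (y k) k * ((y (k + 1) - y k) ^ 2 / (y k * y (k + 1)))) := by
      rw [WaveCoeff.value, h1, h2, h3]
      field_simp
      ring
    rw [h4]
    exact neg_ne_zero.2 (mul_ne_zero (mul_ne_zero (hμ k hk') (ih hk'))
      (div_ne_zero (pow_ne_zero 2 (sub_pos.2 (hlt k hk)).ne') (mul_ne_zero hy0 hy1)))

end wave

/-- Multipeakons with nonzero masses `μ k` in the coordinates `y k = e^{x k}`, for `k < N`. -/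
structure IsExpPeakon (N : ℕ) (y μ : ℕ → ℝ → ℝ) (tc : ℝ) : Prop where
  pos : ∀ k < N, ∀ t ∈ Set.Ioo 0 tc, 0 < y k t
  lt : ∀ k, k + 1 < N → ∀ t ∈ Set.Ioo 0 tc, y k t < y (k + 1) t
  mass_ne_zero : ∀ k < N, ∀ t ∈ Set.Ioo 0 tc, μ k t ≠ 0
  deriv_exp : ∀ k < N, ∀ t ∈ Set.Ioo 0 tc,
    HasDerivAt (y k) (y k t * (rightMoment N (y · t) (μ · t) k * y k t +
      leftMoment (y · t) (μ · t) k / y k t)) t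
  deriv_mass : ∀ k < N, ∀ t ∈ Set.Ioo 0 tc,
    HasDerivAt (μ k) (2 * μ k t * (leftMoment (y · t) (μ · t) k / y k t -
      rightMoment N (y · t) (μ · t) (k + 1) * y k t)) t

namespace IsExpPeakon

variable {N : ℕ} {y μ : ℕ → ℝ → ℝ} {tc : ℝ}

/-- The time evolution of the wave function between two peakons (the second equation of the Lax
pair). -/
theorem hasDerivAt_wave (h : IsExpPeakon N y μ tc) {t : ℝ} (ht : t ∈ Set.Ioo 0 tc) (k : ℕ) :
    k ≤ N → ∀ p,
    HasDerivAt (fun t => (wave (y · t) (μ · t) k).a p)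
      (rightMoment N (y · t) (μ · t) k * (wave (y · t) (μ · t) k).b p) t ∧
    HasDerivAt (fun t => (wave (y · t) (μ · t) k).b p)
      ((wave (y · t) (μ · t) k).b (p + 1)
        + 2 * rightMoment N (y · t) (μ · t) k * (wave (y · t) (μ · t) k).c p
        - 2 * leftMoment (y · t) (μ · t) k * (wave (y · t) (μ · t) k).a p) t ∧
    HasDerivAt (fun t => (wave (y · t) (μ · t) k).c p)
      (-(leftMoment (y · t) (μ · t) k * (wave (y · t) (μ · t) k).b p)) t := by
  induction k with
  | zero =>
    intro _ p
    simp [wave, leftMoment, hasDerivAt_const]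
  | succ k ih =>
    intro hk p
    have hkN : k < N := hk
    have ih := ih hkN.le
    have hy := (h.pos k hkN t ht).ne'
    have hP : rightMoment N (y · t) (μ · t) k =
        μ k t / y k t + rightMoment N (y · t) (μ · t) (k + 1) :=
      Finset.sum_eq_sum_Ico_succ_bot hkN _
    have hQ : leftMoment (y · t) (μ · t) (k + 1) =
        leftMoment (y · t) (μ · t) k + μ k t * y k t := Finset.sum_range_succ _ _
    cases p with
    | zero =>
      -- the constant terms do not change: the wave function is `eˣ` at `z = 0`
      have hz : ∀ s, (wave (y · s) (μ · s) (k + 1)).a 0 = 1 ∧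
        (wave (y · s) (μ · s) (k + 1)).b 0 = 0 ∧ (wave (y · s) (μ · s) (k + 1)).c 0 = 0 :=
        fun s => wave_zero_coeff _
      simp only [fun s => (hz s).1, fun s => (hz s).2.1, fun s => (hz s).2.2, zero_add, wave_b_one]
      refine ⟨(hasDerivAt_const t _).congr_deriv ?_, (hasDerivAt_const t _).congr_deriv ?_,
        (hasDerivAt_const t _).congr_deriv ?_⟩ <;> ring
    | succ p =>
      have dy := h.deriv_exp k hkN t ht
      have dμ := h.deriv_mass k hkN t ht
      have dyi := dy.fun_inv hy
      obtain ⟨da, db, dc⟩ := ih p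
      obtain ⟨da', db', dc'⟩ := ih (p + 1)
      have dv : HasDerivAt (fun t => (wave (y · t) (μ · t) k).value (y k t) p) _ t :=
        ((dy.fun_mul da).fun_add db).fun_add (dyi.fun_mul dc)
      have ea : (fun t => (wave (y · t) (μ · t) (k + 1)).a (p + 1)) = fun t =>
        (wave (y · t) (μ · t) k).a (p + 1) -
          μ k t * (y k t)⁻¹ * (wave (y · t) (μ · t) k).value (y k t) p := rfl
      have eb : (fun t => (wave (y · t) (μ · t) (k + 1)).b (p + 1)) = fun t =>
        (wave (y · t) (μ · t) k).b (p + 1) +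
          2 * μ k t * (wave (y · t) (μ · t) k).value (y k t) p := rfl
      have ec : (fun t => (wave (y · t) (μ · t) (k + 1)).c (p + 1)) = fun t =>
        (wave (y · t) (μ · t) k).c (p + 1) -
          μ k t * y k t * (wave (y · t) (μ · t) k).value (y k t) p := rfl
      have ea' := congrFun ea t
      have eb' := congrFun eb t
      have eb'' : (wave (y · t) (μ · t) (k + 1)).b (p + 1 + 1) =
        (wave (y · t) (μ · t) k).b (p + 1 + 1) +
          2 * μ k t * (wave (y · t) (μ · t) k).value (y k t) (p + 1) := rfl
      have ec' := congrFun ec t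
      simp only at ea' eb' ec'
      rw [ea, eb, ec, ea', eb', eb'', ec', hQ]
      refine ⟨(da'.fun_sub ((dμ.fun_mul dyi).fun_mul dv)).congr_deriv ?_,
        (db'.fun_add ((dμ.const_mul 2).fun_mul dv)).congr_deriv ?_,
        (dc'.fun_sub ((dμ.fun_mul dy).fun_mul dv)).congr_deriv ?_⟩ <;>
      · simp only [WaveCoeff.value]
        rw [hP]
        field_simp
        ring

/-- To the right of all peakons, `a` is conserved, `b` solves a linear equation with constant
coefficients, and the derivative of `c` is quadratic in `b`. -/
theorem hasDerivAt_wave_last (h : IsExpPeakon N y μ tc) {t : ℝ} (ht : t ∈ Set.Ioo 0 tc) (p : ℕ) :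
    HasDerivAt (fun t => (wave (y · t) (μ · t) N).a p) 0 t ∧
    HasDerivAt (fun t => (wave (y · t) (μ · t) N).b p)
      ((wave (y · t) (μ · t) N).b (p + 1)
        - (wave (y · t) (μ · t) N).b 1 * (wave (y · t) (μ · t) N).a p) t ∧
    HasDerivAt (fun t => (wave (y · t) (μ · t) N).c p)
      (-(1 / 2) * ((wave (y · t) (μ · t) N).b 1 * (wave (y · t) (μ · t) N).b p)) t := by
  have hP : rightMoment N (y · t) (μ · t) N = 0 := by simp [rightMoment]
  obtain ⟨h1, h2, h3⟩ := h.hasDerivAt_wave ht N le_rfl p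
  rw [hP] at h1 h2
  refine ⟨h1.congr_deriv (by ring), h2.congr_deriv ?_, h3.congr_deriv ?_⟩ <;>
  · rw [wave_b_one]
    ring

theorem exists_wave_last_a_eq (h : IsExpPeakon N y μ tc) (p : ℕ) :
    ∃ α : ℝ, ∀ t ∈ Set.Ioo 0 tc, (wave (y · t) (μ · t) N).a p = α := by
  have := isOpen_Ioo.exists_is_const_of_deriv_eq_zero (isPreconnected_Ioo (a := (0 : ℝ)) (b := tc))
    (f := fun t => (wave (y · t) (μ · t) N).a p)
    (fun t ht => (h.hasDerivAt_wave_last ht p).1.differentiableAt.differentiableWithinAt)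
    (fun t ht => (h.hasDerivAt_wave_last ht p).1.deriv)
  exact this

theorem exists_analyticAt_wave_last (h : IsExpPeakon N y μ tc) (htc : 0 < tc) (p : ℕ) :
    (∃ g : ℝ → ℝ, AnalyticAt ℝ g tc ∧
      ∀ t ∈ Set.Ioo 0 tc, (wave (y · t) (μ · t) N).b p = g t) ∧
    ∃ g : ℝ → ℝ, AnalyticAt ℝ g tc ∧
      ∀ t ∈ Set.Ioo 0 tc, (wave (y · t) (μ · t) N).c p = g t := by
  by_cases hp : N + 1 < p
  · have h0 := fun t => wave_coeff_of_lt (y := (y · t)) (μ := (μ · t)) N p (by omega)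
    exact ⟨⟨fun _ => 0, analyticAt_const, fun t _ => (h0 t).2.1⟩,
      ⟨fun _ => 0, analyticAt_const, fun t _ => (h0 t).2.2⟩⟩
  choose α hα using h.exists_wave_last_a_eq
  -- `b 0, …, b (N + 1)` solve a linear system with this matrix
  let A : Fin (N + 2) → Fin (N + 2) → ℝ := fun i l =>
    (if (l : ℕ) = i + 1 then 1 else 0) - (if (l : ℕ) = 1 then α i else 0)
  have hsum : ∀ f : ℕ → ℝ, f (N + 2) = 0 → ∀ i : Fin (N + 2),
      ∑ l : Fin (N + 2), A i l * f l = f (i + 1) - f 1 * α i := by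
    intro f hf i
    rw [Fin.sum_univ_eq_sum_range (fun l => ((if l = (i : ℕ) + 1 then 1 else 0) -
      (if l = 1 then α i else 0)) * f l)]
    simp only [sub_mul, Finset.sum_sub_distrib, ite_mul, zero_mul, one_mul, Finset.sum_ite_eq',
      Finset.mem_range]
    rw [if_pos (show 1 < N + 2 by omega)]
    split_ifs with h1
    · ring
    · rw [show (i : ℕ) + 1 = N + 2 by omega, hf]
      ring
  set b : ℕ → ℝ → ℝ := fun i t => (wave (y · t) (μ · t) N).b i
  have hb : ∀ t ∈ Set.Ioo 0 tc, ∀ i : Fin (N + 2), HasDerivAt (b i) (∑ l, A i l * b l t) t := by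
    intro t ht i
    rw [hsum (fun i => b i t) (wave_coeff_of_lt N _ (by omega)).2.1]
    refine (h.hasDerivAt_wave_last ht i).2.1.congr_deriv ?_
    rw [hα _ t ht]
  have hp' : p < N + 2 := by omega
  constructor
  · let L : (Fin (N + 2) → ℝ) →ₗ[ℝ] (Fin (N + 2) → ℝ) := Matrix.toLin' (Matrix.of A)
    obtain ⟨w, hw, hbw⟩ := exists_analyticAt_of_linear_ode (LinearMap.toContinuousLinearMap L)
      (v := fun t i => b i t) htc (fun t ht => hasDerivAt_pi.2 fun i => hb t ht i)
    exact ⟨fun t => w t ⟨p, hp'⟩, (analyticAt_pi_iff.1 hw) _, fun t ht =>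
      congrFun (hbw t ht) ⟨p, hp'⟩⟩
  · -- the products `b i * b l` together with `c p` also solve a linear system
    let L : ((Fin (N + 2) → Fin (N + 2) → ℝ) × ℝ) →ₗ[ℝ]
        ((Fin (N + 2) → Fin (N + 2) → ℝ) × ℝ) :=
      { toFun := fun F => (fun i l => ∑ r, A i r * F.1 r l + ∑ r, A l r * F.1 i r,
          -(1 / 2) * F.1 ⟨1, by omega⟩ ⟨p, hp'⟩)
        map_add' := by
          intro F G
          ext i l
          · simp only [Prod.fst_add, Pi.add_apply, mul_add, Finset.sum_add_distrib]
            ring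
          · simp only [Prod.fst_add, Pi.add_apply, Prod.snd_add]
            ring
        map_smul' := by
          intro r F
          ext i l
          · simp only [Prod.smul_fst, Pi.smul_apply, smul_eq_mul, RingHom.id_apply, mul_add,
              Finset.mul_sum]
            congr 1 <;> exact Finset.sum_congr rfl fun _ _ => by ring
          · simp only [Prod.smul_fst, Prod.smul_snd, Pi.smul_apply, smul_eq_mul, RingHom.id_apply]
            ring }
    obtain ⟨w, hw, hbw⟩ := exists_analyticAt_of_linear_ode (LinearMap.toContinuousLinearMap L)
      (v := fun t => (fun i l => b i t * b l t, (wave (y · t) (μ · t) N).c p)) htc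
      (fun t ht => by
        refine HasDerivAt.prodMk (hasDerivAt_pi.2 fun i => hasDerivAt_pi.2 fun l => ?_)
          (h.hasDerivAt_wave_last ht p).2.2
        refine ((hb t ht i).fun_mul (hb t ht l)).congr_deriv ?_
        rw [Finset.sum_mul, Finset.mul_sum]
        congr 1 <;> exact Finset.sum_congr rfl fun _ _ => by ring)
    exact ⟨fun t => (w t).2, analyticAt_snd.fun_comp hw, fun t ht => congrArg Prod.snd (hbw t ht)⟩

end IsExpPeakon

/-! ### One-sided Laurent expansions -/

/-- To the left of `tc`, `f` is the restriction of a function meromorphic at `tc`. -/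
def IsLeftMeromorphicAt (f : ℝ → ℝ) (tc : ℝ) : Prop :=
  ∃ g : ℝ → ℝ, MeromorphicAt g tc ∧ f =ᶠ[𝓝[<] tc] g

namespace IsLeftMeromorphicAt

variable {f g : ℝ → ℝ} {tc : ℝ}

theorem congr (hf : IsLeftMeromorphicAt f tc) (h : g =ᶠ[𝓝[<] tc] f) :
    IsLeftMeromorphicAt g tc := by
  obtain ⟨F, hF, hfF⟩ := hf
  exact ⟨F, hF, h.trans hfF⟩

theorem const (c : ℝ) : IsLeftMeromorphicAt (fun _ => c) tc :=
  ⟨_, MeromorphicAt.const c tc, EventuallyEq.rfl⟩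

theorem add (hf : IsLeftMeromorphicAt f tc) (hg : IsLeftMeromorphicAt g tc) :
    IsLeftMeromorphicAt (fun t => f t + g t) tc := by
  obtain ⟨F, hF, hfF⟩ := hf
  obtain ⟨G, hG, hgG⟩ := hg
  exact ⟨F + G, hF.add hG, hfF.add hgG⟩

theorem mul (hf : IsLeftMeromorphicAt f tc) (hg : IsLeftMeromorphicAt g tc) :
    IsLeftMeromorphicAt (fun t => f t * g t) tc := by
  obtain ⟨F, hF, hfF⟩ := hf
  obtain ⟨G, hG, hgG⟩ := hg
  exact ⟨F * G, hF.mul hG, hfF.mul hgG⟩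

theorem sub (hf : IsLeftMeromorphicAt f tc) (hg : IsLeftMeromorphicAt g tc) :
    IsLeftMeromorphicAt (fun t => f t - g t) tc := by
  obtain ⟨F, hF, hfF⟩ := hf
  obtain ⟨G, hG, hgG⟩ := hg
  exact ⟨F - G, hF.sub hG, hfF.sub hgG⟩

theorem inv (hf : IsLeftMeromorphicAt f tc) : IsLeftMeromorphicAt (fun t => (f t)⁻¹) tc := by
  obtain ⟨F, hF, hfF⟩ := hf
  exact ⟨F⁻¹, hF.inv, hfF.inv⟩

theorem exists_hasLaurentLeadingTerm (hf : IsLeftMeromorphicAt f tc)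
    (h0 : ∀ᶠ t in 𝓝[<] tc, f t ≠ 0) : ∃ (a : ℝ) (p : ℤ), HasLaurentLeadingTerm f tc a p := by
  obtain ⟨F, hF, hfF⟩ := hf
  have hle : 𝓝[<] tc ≤ 𝓝[≠] tc := nhdsWithin_mono _ fun t ht => ne_of_lt ht
  have hord : meromorphicOrderAt F tc ≠ ⊤ := by
    intro h
    have h1 := (meromorphicOrderAt_eq_top_iff.1 h).filter_mono hle
    obtain ⟨t, h2, h3, h4⟩ := (h0.and (hfF.and h1)).exists
    exact h2 (h3.trans h4)
  obtain ⟨g, hg, hg0, hFg⟩ := (meromorphicOrderAt_ne_top_iff hF).1 hord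
  refine ⟨g tc, (meromorphicOrderAt F tc).untop₀, hg0, g, hg, rfl, ?_⟩
  filter_upwards [hfF, hFg.filter_mono hle] with t h1 h2
  rw [h1, h2, smul_eq_mul]

end IsLeftMeromorphicAt

theorem tendsto_sub_left (tc : ℝ) : Tendsto (fun t => t - tc) (𝓝[<] tc) (𝓝 0) := by
  have h : Continuous fun t : ℝ => t - tc := by fun_prop
  simpa using (h.tendsto tc).mono_left nhdsWithin_le_nhds

namespace HasLaurentLeadingTerm

variable {f f' : ℝ → ℝ} {tc a : ℝ} {p : ℤ}

theorem tendsto (h : HasLaurentLeadingTerm f tc a p) :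
    Tendsto (fun t => (t - tc) ^ (-p) * f t) (𝓝[<] tc) (𝓝 a) := by
  obtain ⟨ha, g, hg, rfl, hfg⟩ := h
  refine (hg.continuousAt.tendsto.mono_left nhdsWithin_le_nhds).congr' ?_
  filter_upwards [hfg, self_mem_nhdsWithin] with t h1 h2
  have h3 : t - tc ≠ 0 := (sub_neg.2 h2).ne
  rw [h1, ← mul_assoc, ← zpow_add₀ h3, neg_add_cancel, zpow_zero, one_mul]

/-- The logarithmic derivative has a simple pole, with the order as its residue. -/
theorem tendsto_logDeriv (h : HasLaurentLeadingTerm f tc a p)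
    (hf' : ∀ᶠ t in 𝓝[<] tc, HasDerivAt f (f' t) t) :
    Tendsto (fun t => (t - tc) * (f' t / f t)) (𝓝[<] tc) (𝓝 p) := by
  obtain ⟨ha, g, hg, rfl, hfg⟩ := h
  have h1 : Tendsto (fun t => p + (t - tc) * (deriv g t / g t)) (𝓝[<] tc)
      (𝓝 (p + 0 * (deriv g tc / g tc))) :=
    ((tendsto_sub_left tc).mul ((hg.deriv.continuousAt.tendsto.div hg.continuousAt.tendsto
      ha).mono_left nhdsWithin_le_nhds)).const_add _
  rw [zero_mul, add_zero] at h1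
  refine h1.congr' ?_
  filter_upwards [hf', eventually_eventually_nhdsWithin.2 hfg, self_mem_nhdsWithin,
    hg.eventually_analyticAt.filter_mono nhdsWithin_le_nhds,
    (hg.continuousAt.eventually_ne ha).filter_mono nhdsWithin_le_nhds] with t h1 h2 h3 h4 h5
  rw [isOpen_Iio.nhdsWithin_eq h3] at h2
  have h6 : t - tc ≠ 0 := (sub_neg.2 h3).ne
  have h7 : HasDerivAt (fun t => (t - tc) ^ p * g t)
      (p * (t - tc) ^ (p - 1) * 1 * g t + (t - tc) ^ p * deriv g t) t :=
    (((hasDerivAt_zpow p (t - tc) (Or.inl h6)).comp_sub_const t tc).congr_deriv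
      (by ring)).fun_mul h4.differentiableAt.hasDerivAt
  rw [h1.unique (h7.congr_of_eventuallyEq h2), h2.self_of_nhds, zpow_sub_one₀ h6]
  have h8 := zpow_ne_zero p h6
  field_simp

theorem exponent_nonneg (h : HasLaurentLeadingTerm f tc a p) (r : ℤ)
    (hb : IsBoundedUnder (· ≤ ·) (𝓝[<] tc) fun t => ‖(t - tc) ^ r * f t‖) : 0 ≤ p + r := by
  by_contra! hlt
  refine h.1 (tendsto_nhds_unique h.tendsto ?_)
  obtain ⟨d, hd⟩ : ∃ d : ℕ, -p = (d + 1 : ℕ) + r := ⟨(-p - r - 1).toNat, by omega⟩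
  have h1 : Tendsto (fun t => (t - tc) ^ (d + 1)) (𝓝[<] tc) (𝓝 0) := by
    simpa using (tendsto_sub_left tc).pow (d + 1)
  refine (h1.zero_mul_isBoundedUnder_le hb).congr' ?_
  filter_upwards [self_mem_nhdsWithin] with t h2
  have h3 : t - tc ≠ 0 := (sub_neg.2 h2).ne
  rw [hd, zpow_add₀ h3, zpow_natCast, mul_assoc]

theorem tendsto_of_exponent_zero (h : HasLaurentLeadingTerm f tc a 0) :
    Tendsto f (𝓝[<] tc) (𝓝 a) := by
  simpa using h.tendsto

theorem tendsto_zero_of_exponent_pos (h : HasLaurentLeadingTerm f tc a p) (hp : 0 < p) :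
    Tendsto f (𝓝[<] tc) (𝓝 0) := by
  lift p to ℕ using hp.le
  have h1 : Tendsto (fun t => (t - tc) ^ p) (𝓝[<] tc) (𝓝 (0 ^ p)) := (tendsto_sub_left tc).pow p
  rw [zero_pow (by omega)] at h1
  have h2 := h1.mul h.tendsto
  rw [zero_mul] at h2
  refine h2.congr' ?_
  filter_upwards [self_mem_nhdsWithin] with t h3
  have h4 : t - tc ≠ 0 := (sub_neg.2 h3).ne
  rw [← mul_assoc, zpow_neg, zpow_natCast, mul_inv_cancel₀ (pow_ne_zero _ h4), one_mul]

/-- A function with a simple pole blows up. -/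
theorem blowsUpAt (h : HasLaurentLeadingTerm f tc a (-1)) : BlowsUpAt f tc := by
  intro C hC
  refine absurd (h.exponent_nonneg 0 ?_) (by norm_num)
  refine ⟨C, eventually_map.2 ?_⟩
  filter_upwards [hC] with t ht
  simpa using not_lt.1 ht

end HasLaurentLeadingTerm

/-! ### Recovering the peakons from the wave function -/

theorem eventually_mem_Ioo_left {tc : ℝ} (htc : 0 < tc) : ∀ᶠ t in 𝓝[<] tc, t ∈ Set.Ioo 0 tc :=
  Ioo_mem_nhdsLT htc

namespace IsExpPeakon

variable {N : ℕ} {y μ : ℕ → ℝ → ℝ} {tc : ℝ}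

theorem value_top_ne_zero (h : IsExpPeakon N y μ tc) {t : ℝ} (ht : t ∈ Set.Ioo 0 tc) {k : ℕ}
    (hk : k < N) : (wave (y · t) (μ · t) k).value (y k t) k ≠ 0 :=
  wave_value_top_ne_zero (fun k hk => h.pos k hk t ht) (fun k hk => h.lt k hk t ht)
    (fun k hk => h.mass_ne_zero k hk t ht) k hk

theorem exp_eq_div (h : IsExpPeakon N y μ tc) {t : ℝ} (ht : t ∈ Set.Ioo 0 tc) {k : ℕ}
    (hk : k < N) : (wave (y · t) (μ · t) (k + 1)).a (k + 1) ≠ 0 ∧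
    y k t = -(1 / 2) * ((wave (y · t) (μ · t) (k + 1)).b (k + 1) *
      ((wave (y · t) (μ · t) (k + 1)).a (k + 1))⁻¹) := by
  obtain ⟨h1, h2, -⟩ := wave_top_coeff (y := (y · t)) (μ := (μ · t)) k
  have h3 := h.value_top_ne_zero ht hk
  have h4 := h.mass_ne_zero k hk t ht
  have h5 := (h.pos k hk t ht).ne'
  rw [h1, h2]
  refine ⟨neg_ne_zero.2 (mul_ne_zero (mul_ne_zero h4 (inv_ne_zero h5)) h3), ?_⟩
  field_simp

/-- One step of the inverse problem: the leading coefficients of the wave function to the right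
of a peakon determine its position, then its mass, and hence the wave function to its left. -/
theorem isLeftMeromorphicAt_step (h : IsExpPeakon N y μ tc) (htc : 0 < tc) {k : ℕ} (hk : k < N)
    (hw : ∀ p, IsLeftMeromorphicAt (fun t => (wave (y · t) (μ · t) (k + 1)).a p) tc ∧
      IsLeftMeromorphicAt (fun t => (wave (y · t) (μ · t) (k + 1)).b p) tc ∧
      IsLeftMeromorphicAt (fun t => (wave (y · t) (μ · t) (k + 1)).c p) tc) :
    IsLeftMeromorphicAt (y k) tc ∧ IsLeftMeromorphicAt (μ k) tc ∧
    ∀ p, IsLeftMeromorphicAt (fun t => (wave (y · t) (μ · t) k).a p) tc ∧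
      IsLeftMeromorphicAt (fun t => (wave (y · t) (μ · t) k).b p) tc ∧
      IsLeftMeromorphicAt (fun t => (wave (y · t) (μ · t) k).c p) tc := by
  have hy : IsLeftMeromorphicAt (y k) tc := by
    refine ((IsLeftMeromorphicAt.const (-(1 / 2))).mul
      ((hw (k + 1)).2.1.mul (hw (k + 1)).1.inv)).congr ?_
    filter_upwards [eventually_mem_Ioo_left htc] with t ht
    exact (h.exp_eq_div ht hk).2
  have hv : ∀ p, IsLeftMeromorphicAt (fun t => (wave (y · t) (μ · t) k).value (y k t) p) tc := by
    intro p
    refine (((hy.mul (hw p).1).add (hw p).2.1).add (hy.inv.mul (hw p).2.2)).congr ?_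
    filter_upwards [eventually_mem_Ioo_left htc] with t ht
    exact (WaveCoeff.value_jump (h.pos k hk t ht).ne' (μ k t) _ p).symm
  have hμ : IsLeftMeromorphicAt (μ k) tc := by
    refine ((IsLeftMeromorphicAt.const (1 / 2)).mul ((hw (k + 1)).2.1.mul (hv k).inv)).congr ?_
    filter_upwards [eventually_mem_Ioo_left htc] with t ht
    rw [(wave_top_coeff k).2.1]
    have := h.value_top_ne_zero ht hk
    field_simp
  refine ⟨hy, hμ, fun p => ?_⟩
  cases p with
  | zero => exact hw 0
  | succ p =>
    refine ⟨((hw (p + 1)).1.add ((hμ.mul hy.inv).mul (hv p))).congr (Eventually.of_forall ?_),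
      ((hw (p + 1)).2.1.sub (((IsLeftMeromorphicAt.const 2).mul hμ).mul (hv p))).congr
        (Eventually.of_forall ?_),
      ((hw (p + 1)).2.2.add ((hμ.mul hy).mul (hv p))).congr (Eventually.of_forall ?_)⟩ <;>
    · intro t
      simp [wave, WaveCoeff.jump]

theorem isLeftMeromorphicAt (h : IsExpPeakon N y μ tc) (htc : 0 < tc) {k : ℕ} (hk : k < N) :
    IsLeftMeromorphicAt (y k) tc ∧ IsLeftMeromorphicAt (μ k) tc := by
  have key : ∀ d k : ℕ, k + d = N →
      ∀ p, IsLeftMeromorphicAt (fun t => (wave (y · t) (μ · t) k).a p) tc ∧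
      IsLeftMeromorphicAt (fun t => (wave (y · t) (μ · t) k).b p) tc ∧
      IsLeftMeromorphicAt (fun t => (wave (y · t) (μ · t) k).c p) tc := by
    intro d
    induction d with
    | zero =>
      rintro k rfl p
      obtain ⟨α, hα⟩ := h.exists_wave_last_a_eq p
      obtain ⟨⟨g, hg, hbg⟩, g', hg', hcg⟩ := h.exists_analyticAt_wave_last htc p
      exact ⟨⟨_, MeromorphicAt.const α tc, (eventually_mem_Ioo_left htc).mono hα⟩,
        ⟨g, hg.meromorphicAt, (eventually_mem_Ioo_left htc).mono hbg⟩,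
        ⟨g', hg'.meromorphicAt, (eventually_mem_Ioo_left htc).mono hcg⟩⟩
    | succ d ih =>
      intro k hkd
      exact (h.isLeftMeromorphicAt_step htc (by omega) (ih (k + 1) (by omega))).2.2
  obtain ⟨h1, h2, -⟩ := h.isLeftMeromorphicAt_step htc hk (key (N - (k + 1)) (k + 1) (by omega))
  exact ⟨h1, h2⟩

/-- The last peakon is bounded from above, since the leading coefficient of `a` is conserved. -/
theorem exists_last_le {M : ℕ} (h : IsExpPeakon (M + 1) y μ tc) (htc : 0 < tc) :
    ∃ C, ∀ᶠ t in 𝓝[<] tc, y M t ≤ C := by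
  obtain ⟨α, hα⟩ := h.exists_wave_last_a_eq (M + 1)
  obtain ⟨⟨g, hg, hbg⟩, -⟩ := h.exists_analyticAt_wave_last htc (M + 1)
  have h1 : Tendsto (fun t => -(1 / 2) * (g t * α⁻¹)) (𝓝[<] tc)
      (𝓝 (-(1 / 2) * (g tc * α⁻¹))) :=
    ((hg.continuousAt.tendsto.mono_left nhdsWithin_le_nhds).mul_const _).const_mul _
  refine ⟨-(1 / 2) * (g tc * α⁻¹) + 1, ?_⟩
  filter_upwards [eventually_mem_Ioo_left htc, h1.eventually_le_const (lt_add_one _)] with t ht h2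
  rw [(h.exp_eq_div ht (Nat.lt_succ_self M)).2, hα t ht, hbg t ht]
  exact h2

end IsExpPeakon

/-! ### Analysis at the blow-up time -/

namespace IsExpPeakon

variable {N : ℕ} {y μ : ℕ → ℝ → ℝ} {tc : ℝ}

theorem le_of_le (h : IsExpPeakon N y μ tc) {t : ℝ} (ht : t ∈ Set.Ioo 0 tc) {i j : ℕ}
    (hij : i ≤ j) (hj : j < N) : y i t ≤ y j t := by
  induction j, hij using Nat.le_induction with
  | base => exact le_rfl
  | succ j hij ih => exact (ih (by omega)).trans (h.lt j hj t ht).le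

/-- The positions have finite limits, and the velocities are `o(1 / (tc - t))`. -/
theorem exists_tendsto_exp (h : IsExpPeakon N y μ tc) (htc : 0 < tc) {c C : ℝ} (hc : 0 < c)
    {k : ℕ} (hk : k < N) (hcC : ∀ᶠ t in 𝓝[<] tc, c ≤ y k t ∧ y k t ≤ C) :
    ∃ Y, 0 < Y ∧ Tendsto (y k) (𝓝[<] tc) (𝓝 Y) ∧
      Tendsto (fun t => (t - tc) * (rightMoment N (y · t) (μ · t) k * y k t +
        leftMoment (y · t) (μ · t) k / y k t)) (𝓝[<] tc) (𝓝 0) := by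
  have hmem := eventually_mem_Ioo_left htc
  obtain ⟨Y, p, hY⟩ := (h.isLeftMeromorphicAt htc hk).1.exists_hasLaurentLeadingTerm
    (hmem.mono fun t ht => (h.pos k hk t ht).ne')
  have hbdd : IsBoundedUnder (· ≤ ·) (𝓝[<] tc) fun t => ‖(t - tc) ^ (0 : ℤ) * y k t‖ := by
    refine ⟨C, eventually_map.2 ?_⟩
    filter_upwards [hcC] with t ht
    rw [zpow_zero, one_mul, Real.norm_of_nonneg (hc.le.trans ht.1)]
    exact ht.2
  have hp : 0 ≤ p := by simpa using hY.exponent_nonneg 0 hbdd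
  have hp0 : p = 0 := by
    by_contra hne
    exact hc.not_ge (ge_of_tendsto
      (hY.tendsto_zero_of_exponent_pos (lt_of_le_of_ne hp (Ne.symm hne)))
      (hcC.mono fun t ht => ht.1))
  subst hp0
  refine ⟨Y, hc.trans_le (ge_of_tendsto hY.tendsto_of_exponent_zero (hcC.mono fun t ht => ht.1)),
    hY.tendsto_of_exponent_zero, ?_⟩
  have h1 := hY.tendsto_logDeriv (hmem.mono fun t ht => h.deriv_exp k hk t ht)
  rw [Int.cast_zero] at h1
  refine h1.congr' ?_
  filter_upwards [hmem] with t ht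
  rw [mul_div_cancel_left₀ _ (h.pos k hk t ht).ne']

/-- The velocity at the peakon `k`, written with the moments to the right of it. -/
theorem velocity_eq (h : IsExpPeakon N y μ tc) {t : ℝ} (ht : t ∈ Set.Ioo 0 tc) {k : ℕ}
    (hk : k < N) : rightMoment N (y · t) (μ · t) k * y k t +
      leftMoment (y · t) (μ · t) k / y k t = rightMoment N (y · t) (μ · t) (k + 1) * y k t +
      leftMoment (y · t) (μ · t) (k + 1) / y k t := by
  have hP : rightMoment N (y · t) (μ · t) k =
      μ k t / y k t + rightMoment N (y · t) (μ · t) (k + 1) :=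
    Finset.sum_eq_sum_Ico_succ_bot hk _
  have hQ : leftMoment (y · t) (μ · t) (k + 1) =
      leftMoment (y · t) (μ · t) k + μ k t * y k t := Finset.sum_range_succ _ _
  have := (h.pos k hk t ht).ne'
  rw [hP, hQ]
  field_simp
  ring

/-- For neighbouring peakons with limits `Y` and `Y'`, let `q` be the order of vanishing of the gap
between them. The derivative of `y (k + 1) - y k` is `P (y (k + 1) ^ 2 - y k ^ 2)`, where `P` is the
coefficient of `eˣ` in the velocity field between the two peakons; so `P` has residue
`q / (Y + Y')`. -/
theorem exists_gap_order (h : IsExpPeakon N y μ tc) (htc : 0 < tc) {k : ℕ} (hk : k + 1 < N)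
    {Y Y' : ℝ} (hY0 : 0 < Y) (hY0' : 0 < Y') (hY : Tendsto (y k) (𝓝[<] tc) (𝓝 Y))
    (hY' : Tendsto (y (k + 1)) (𝓝[<] tc) (𝓝 Y')) :
    ∃ q : ℕ, (q ≠ 0 → Y = Y') ∧
      Tendsto (fun t => (t - tc) * (rightMoment N (y · t) (μ · t) (k + 1) * y k t)) (𝓝[<] tc)
        (𝓝 (q / 2)) ∧
      Tendsto (fun t => (t - tc) * (rightMoment N (y · t) (μ · t) (k + 1) * y (k + 1) t))
        (𝓝[<] tc) (𝓝 (q / 2)) := by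
  have hmem := eventually_mem_Ioo_left htc
  have hk' : k < N := by omega
  have hmer := (h.isLeftMeromorphicAt htc hk).1.sub (h.isLeftMeromorphicAt htc hk').1
  obtain ⟨a, p, hD⟩ := hmer.exists_hasLaurentLeadingTerm
    (hmem.mono fun t ht => (sub_pos.2 (h.lt k hk t ht)).ne')
  have hlim := hY'.sub hY
  have hp : 0 ≤ p := by
    have h1 := hD.exponent_nonneg 0
      (by simpa only [zpow_zero, one_mul] using hlim.norm.isBoundedUnder_le)
    simpa using h1
  lift p to ℕ using hp
  have hder : ∀ᶠ t in 𝓝[<] tc, HasDerivAt (fun t => y (k + 1) t - y k t)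
      (rightMoment N (y · t) (μ · t) (k + 1) * (y (k + 1) t + y k t) *
        (y (k + 1) t - y k t)) t := by
    filter_upwards [hmem] with t ht
    refine ((h.deriv_exp _ hk t ht).sub (h.deriv_exp _ hk' t ht)).congr_deriv ?_
    rw [h.velocity_eq ht hk']
    have h1 := (h.pos k hk' t ht).ne'
    have h2 := (h.pos _ hk t ht).ne'
    field_simp
    ring
  have hlog := hD.tendsto_logDeriv hder
  rw [Int.cast_natCast] at hlog
  have hq : p ≠ 0 → Y = Y' := by
    intro hp
    have h1 := hD.tendsto_zero_of_exponent_pos (by exact_mod_cast Nat.pos_of_ne_zero hp)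
    exact (sub_eq_zero.1 (tendsto_nhds_unique hlim h1)).symm
  have hP : Tendsto (fun t => (t - tc) * rightMoment N (y · t) (μ · t) (k + 1)) (𝓝[<] tc)
      (𝓝 (p / (Y' + Y))) := by
    refine (hlog.div (hY'.add hY) (by positivity)).congr' ?_
    filter_upwards [hmem] with t ht
    have h1 := h.pos k hk' t ht
    have h2 := h.pos _ hk t ht
    have h3 := (sub_pos.2 (h.lt k hk t ht)).ne'
    have h4 : y (k + 1) t + y k t ≠ 0 := by positivity
    rw [Pi.div_apply]
    field_simp
  have hval : ∀ Z, Z = Y ∨ Z = Y' → (p : ℝ) / (Y' + Y) * Z = p / 2 := by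
    intro Z hZ
    rcases eq_or_ne p 0 with rfl | hp
    · simp
    · have h1 := hq hp
      subst h1
      rw [or_self] at hZ
      subst hZ
      field_simp
      ring
  refine ⟨p, hq, ?_, ?_⟩
  · rw [← hval Y (Or.inl rfl)]
    exact (hP.mul hY).congr fun t => by ring
  · rw [← hval Y' (Or.inr rfl)]
    exact (hP.mul hY').congr fun t => by ring

/-- The local structure at `tc` of peakons with bounded positions. Here `q k` is the order of
vanishing of the gap between the peakons `k - 1` and `k` (and zero at both ends). The mass `μ k`
has at most a simple pole, with residue `(q k - q (k + 1)) / 2`, while its logarithmic derivative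
gives its order as `-(q k + q (k + 1))`; hence `q k + q (k + 1) ≤ 1`. -/
theorem exists_gap_orders (h : IsExpPeakon N y μ tc) (htc : 0 < tc) {c C : ℝ} (hc : 0 < c)
    (hcC : ∀ k < N, ∀ᶠ t in 𝓝[<] tc, c ≤ y k t ∧ y k t ≤ C) :
    ∃ q : ℕ → ℕ, q 0 = 0 ∧ q N = 0 ∧
      (∀ k, k + 1 < N → q (k + 1) ≠ 0 → ∃ Y, 0 < Y ∧ Tendsto (y k) (𝓝[<] tc) (𝓝 Y) ∧
        Tendsto (y (k + 1)) (𝓝[<] tc) (𝓝 Y)) ∧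
      ∀ k < N, (q k + q (k + 1) = 0 ∧ ∃ a, Tendsto (μ k) (𝓝[<] tc) (𝓝 a)) ∨
        (q k + q (k + 1) = 1 ∧
          HasLaurentLeadingTerm (μ k) tc (((q k : ℝ) - q (k + 1)) / 2) (-1)) := by
  have hmem := eventually_mem_Ioo_left htc
  choose! Y hY0 hY hU using fun k (hk : k < N) => h.exists_tendsto_exp htc hc hk (hcC k hk)
  have hq : ∀ k, ∃ q : ℕ, k ≤ N → ((k = 0 ∨ k = N → q = 0) ∧
      (k < N → Tendsto (fun t => (t - tc) * (rightMoment N (y · t) (μ · t) k * y k t)) (𝓝[<] tc)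
        (𝓝 (q / 2))) ∧
      ∀ i, k = i + 1 →
        (k < N → q ≠ 0 → Y i = Y k) ∧
        Tendsto (fun t => (t - tc) * (rightMoment N (y · t) (μ · t) k * y i t)) (𝓝[<] tc)
          (𝓝 (q / 2))) := by
    intro k
    rcases Nat.lt_or_ge N k with hk | hk
    · exact ⟨0, fun h => absurd h hk.not_ge⟩
    rcases hk.eq_or_lt with rfl | hk
    · refine ⟨0, fun _ => ⟨fun _ => rfl, fun h => absurd h (lt_irrefl _),
        fun i _ => ⟨fun h => absurd h (lt_irrefl _), ?_⟩⟩⟩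
      simp [rightMoment]
    cases k with
    | zero =>
      refine ⟨0, fun _ => ⟨fun _ => rfl, fun _ => ?_, fun i hi => by omega⟩⟩
      simpa [leftMoment] using hU 0 hk
    | succ k =>
      have hk' : k < N := by omega
      obtain ⟨q, h1, h2, h3⟩ :=
        h.exists_gap_order htc hk (hY0 k hk') (hY0 _ hk) (hY k hk') (hY _ hk)
      refine ⟨q, fun _ => ⟨by omega, fun _ => h3, ?_⟩⟩
      rintro i hi
      obtain rfl : k = i := by omega
      exact ⟨fun _ => h1, h2⟩
  choose q hq using hq
  refine ⟨q, (hq 0 (Nat.zero_le _)).1 (Or.inl rfl), (hq N le_rfl).1 (Or.inr rfl), ?_, ?_⟩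
  · intro k hk hqk
    have h1 := ((hq (k + 1) hk.le).2.2 k rfl).1 hk hqk
    have hk' : k < N := by omega
    exact ⟨Y k, hY0 k hk', hY k hk', h1 ▸ hY _ hk⟩
  intro k hk
  have hl := (hq k hk.le).2.1 hk
  have hr := ((hq (k + 1) hk).2.2 k rfl).2
  -- the residue of the mass, from `μ k e^{-x k} = P k - P (k + 1)`
  have hres : Tendsto (fun t => (t - tc) ^ (1 : ℤ) * μ k t) (𝓝[<] tc)
      (𝓝 (((q k : ℝ) - q (k + 1)) / 2)) := by
    rw [sub_div]
    refine (hl.sub hr).congr' ?_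
    filter_upwards [hmem] with t ht
    have hP : rightMoment N (y · t) (μ · t) k =
        μ k t / y k t + rightMoment N (y · t) (μ · t) (k + 1) :=
      Finset.sum_eq_sum_Ico_succ_bot hk _
    have := (h.pos k hk t ht).ne'
    rw [hP, zpow_one]
    field_simp
    ring
  obtain ⟨a, p, hμ⟩ := (h.isLeftMeromorphicAt htc hk).2.exists_hasLaurentLeadingTerm
    (hmem.mono fun t ht => h.mass_ne_zero k hk t ht)
  have hp1 : 0 ≤ p + 1 := hμ.exponent_nonneg 1 hres.norm.isBoundedUnder_le
  -- the order of the mass, from its logarithmic derivative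
  have hlog := hμ.tendsto_logDeriv (hmem.mono fun t ht => h.deriv_mass k hk t ht)
  have hlog' := (((hU k hk).sub hl).sub hr).const_mul 2
  have hp : (p : ℝ) = 2 * (0 - (q k : ℝ) / 2 - q (k + 1) / 2) := by
    refine tendsto_nhds_unique hlog (hlog'.congr' ?_)
    filter_upwards [hmem] with t ht
    have := h.mass_ne_zero k hk t ht
    field_simp
    ring
  have hpq : p = -((q k : ℤ) + q (k + 1)) := by
    have : (p : ℝ) = -((q k : ℝ) + q (k + 1)) := by rw [hp]; ring
    exact_mod_cast this
  rcases (show q k + q (k + 1) = 0 ∨ q k + q (k + 1) = 1 by omega) with h0 | h1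
  · obtain rfl : p = 0 := by omega
    exact Or.inl ⟨h0, a, hμ.tendsto_of_exponent_zero⟩
  · obtain rfl : p = -1 := by omega
    have ha : a = ((q k : ℝ) - q (k + 1)) / 2 := by
      refine tendsto_nhds_unique hμ.tendsto ?_
      simpa only [neg_neg] using hres
    exact Or.inr ⟨h1, ha ▸ hμ⟩

end IsExpPeakon

/-! ### Pairing of the blow-ups -/

/-- If `q` vanishes at `0` and `N`, and the values `q i + q (i + 1) ≤ 1` are equal to `1` exactly at
`j 0 < j 1 < ⋯`, then the `j s` form pairs of neighbours: the number of them below `r` has the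
parity of `q r`. -/
theorem pairing_of_gap_orders {N k : ℕ} {q : ℕ → ℕ} (h0 : q 0 = 0) (hN : q N = 0)
    (hq : ∀ i < N, q i + q (i + 1) ≤ 1) {j : Fin k → ℕ} (hj : StrictMono j) (hjN : ∀ s, j s < N)
    (hr : ∀ i < N, q i + q (i + 1) = 1 ↔ i ∈ Set.range j) :
    Even k ∧ (∀ s : Fin k, q (j s) = s % 2 ∧ q (j s + 1) = 1 - s % 2) ∧
    ∀ (l : ℕ) (hl : l + 1 < k), Even l → j ⟨l + 1, hl⟩ = j ⟨l, by omega⟩ + 1 := by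
  have hcount : ∀ r ≤ N, (Finset.univ.filter fun s => j s < r).card % 2 = q r % 2 := by
    intro r
    induction r with
    | zero => simp [h0]
    | succ r ih =>
      intro hrN
      have ih := ih (by omega)
      have hqr := hq r hrN
      by_cases hmem : r ∈ Set.range j
      · obtain ⟨s, rfl⟩ := hmem
        have h1 : (Finset.univ.filter fun s' => j s' < j s + 1) =
            insert s (Finset.univ.filter fun s' => j s' < j s) := by
          ext s'
          simp only [Finset.mem_filter, Finset.mem_univ, true_and, Finset.mem_insert,
            ← hj.injective.eq_iff]
          omega
        have h2 := (hr (j s) hrN).2 ⟨s, rfl⟩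
        rw [h1, Finset.card_insert_of_notMem (by simp)]
        omega
      · have h1 : (Finset.univ.filter fun s' => j s' < r + 1) =
            (Finset.univ.filter fun s' => j s' < r) := by
          ext s'
          have : j s' ≠ r := fun h => hmem ⟨s', h⟩
          simp only [Finset.mem_filter, Finset.mem_univ, true_and]
          omega
        have h2 := (hr r hrN).not.2 hmem
        rw [h1]
        omega
  have hqs : ∀ s : Fin k, q (j s) = s % 2 ∧ q (j s + 1) = 1 - s % 2 := by
    intro s
    have h1 := hcount (j s) (hjN s).le
    have h2 : (Finset.univ.filter fun s' => j s' < j s) = Finset.Iio s := by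
      ext s'
      simp [hj.lt_iff_lt]
    rw [h2, Fin.card_Iio] at h1
    have h3 := (hr (j s) (hjN s)).2 ⟨s, rfl⟩
    omega
  refine ⟨?_, hqs, ?_⟩
  · have h1 := hcount N le_rfl
    rw [Finset.filter_true_of_mem fun s _ => hjN s, Finset.card_univ, Fintype.card_fin, hN] at h1
    exact Nat.even_iff.2 h1
  · intro l hl hle
    obtain ⟨h1, h2⟩ := hqs ⟨l, by omega⟩
    have h3 : l % 2 = 0 := Nat.even_iff.1 hle
    simp only [h3] at h1 h2
    have h4 : j ⟨l, by omega⟩ + 1 < N := by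
      refine lt_of_le_of_ne (hjN _) fun h => ?_
      rw [h, hN] at h2
      omega
    have h5 := hq _ h4
    obtain ⟨s, hs⟩ := (hr _ h4).1 (by omega)
    have h6 : (⟨l, by omega⟩ : Fin k) < s := hj.lt_iff_lt.1 (by omega)
    have h7 : (⟨l + 1, hl⟩ : Fin k) ≤ s := Fin.le_def.2 (Fin.lt_def.1 h6)
    have h8 : j ⟨l, by omega⟩ < j ⟨l + 1, hl⟩ := hj (Fin.lt_def.2 (Nat.lt_succ_self l))
    have h9 := hj.monotone h7
    omega

/-! ### Multipeakons in exponential coordinates -/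

/-- A family indexed by `Fin N` as a family indexed by `ℕ`, zero for indices `≥ N`. -/
def extendByZero {N : ℕ} (f : Fin N → ℝ → ℝ) (k : ℕ) (t : ℝ) : ℝ :=
  if hk : k < N then f ⟨k, hk⟩ t else 0

theorem extendByZero_coe {N : ℕ} (f : Fin N → ℝ → ℝ) (i : Fin N) : extendByZero f i = f i := by
  funext t
  simp [extendByZero]

namespace IsMultipeakon

variable {N : ℕ} {x m : Fin N → ℝ → ℝ} {tc : ℝ}

theorem isExpPeakon (h : IsMultipeakon x m tc) (hm : ∀ i, ∀ t ∈ Set.Ioo 0 tc, m i t ≠ 0) :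
    IsExpPeakon N (fun k t => Real.exp (extendByZero x k t)) (extendByZero m) tc := by
  have hlt : ∀ {i k : ℕ} {t : ℝ}, t ∈ Set.Ioo 0 tc → i < k → k < N →
      extendByZero x i t < extendByZero x k t := by
    intro i k t ht hik hk
    have := h.strictMono_position ⟨ht.1.le, ht.2⟩
      (show (⟨i, hik.trans hk⟩ : Fin N) < ⟨k, hk⟩ from hik)
    simpa [extendByZero, hk, hik.trans hk] using this
  have hleft : ∀ {k : ℕ} {t : ℝ}, t ∈ Set.Ioo 0 tc → k < N → ∀ i ∈ Finset.range k,
      extendByZero m i t * Real.exp (-|extendByZero x k t - extendByZero x i t|) =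
      extendByZero m i t * Real.exp (extendByZero x i t) / Real.exp (extendByZero x k t) := by
    intro k t ht hk i hi
    rw [abs_of_pos (sub_pos.2 (hlt ht (Finset.mem_range.1 hi) hk)), neg_sub, Real.exp_sub,
      mul_div_assoc]
  have hright : ∀ {k : ℕ} {t : ℝ}, t ∈ Set.Ioo 0 tc → ∀ i ∈ Finset.Ico k N,
      extendByZero m i t * Real.exp (-|extendByZero x k t - extendByZero x i t|) =
      extendByZero m i t / Real.exp (extendByZero x i t) * Real.exp (extendByZero x k t) := by
    intro k t ht i hi
    obtain ⟨h1, h2⟩ := Finset.mem_Ico.1 hi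
    have h3 : extendByZero x k t ≤ extendByZero x i t := by
      rcases h1.eq_or_lt with rfl | h1
      · exact le_rfl
      · exact (hlt ht h1 h2).le
    rw [abs_of_nonpos (sub_nonpos.2 h3), neg_neg, Real.exp_sub]
    ring
  refine ⟨fun k _ t _ => Real.exp_pos _, fun k hk t ht =>
    Real.exp_lt_exp.2 (hlt ht (Nat.lt_succ_self k) hk), fun k hk t ht => ?_, fun k hk t ht => ?_,
    fun k hk t ht => ?_⟩
  · simpa [extendByZero, hk] using hm ⟨k, hk⟩ t ht
  · have hx : extendByZero x k = x ⟨k, hk⟩ := extendByZero_coe x ⟨k, hk⟩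
    have h1 : HasDerivAt (extendByZero x k) (∑ i : Fin N, extendByZero m i t *
        Real.exp (-|extendByZero x k t - extendByZero x i t|)) t := by
      simpa only [extendByZero_coe, hx] using h.deriv_position ⟨k, hk⟩ t ht
    refine h1.exp.congr_deriv ?_
    congr 1
    rw [Fin.sum_univ_eq_sum_range (fun i => extendByZero m i t *
      Real.exp (-|extendByZero x k t - extendByZero x i t|)),
      ← Finset.sum_range_add_sum_Ico _ hk.le, Finset.sum_congr rfl (hleft ht hk),
      Finset.sum_congr rfl (hright ht), ← Finset.sum_div, ← Finset.sum_mul, add_comm]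
    rfl
  · have hx : extendByZero x k = x ⟨k, hk⟩ := extendByZero_coe x ⟨k, hk⟩
    have hm : extendByZero m k = m ⟨k, hk⟩ := extendByZero_coe m ⟨k, hk⟩
    have h1 : HasDerivAt (extendByZero m k) (2 * extendByZero m k t * ∑ i : Fin N,
        extendByZero m i t * Real.sign (extendByZero x k t - extendByZero x i t) *
          Real.exp (-|extendByZero x k t - extendByZero x i t|)) t := by
      simpa only [extendByZero_coe, hx, hm] using h.deriv_mass ⟨k, hk⟩ t ht
    refine h1.congr_deriv ?_
    congr 1
    rw [Fin.sum_univ_eq_sum_range (fun i => extendByZero m i t *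
      Real.sign (extendByZero x k t - extendByZero x i t) *
      Real.exp (-|extendByZero x k t - extendByZero x i t|)),
      ← Finset.sum_range_add_sum_Ico _ hk.le, Finset.sum_eq_sum_Ico_succ_bot hk, sub_self,
      Real.sign_zero, mul_zero, zero_mul, zero_add, leftMoment, rightMoment, Finset.sum_div,
      Finset.sum_mul, sub_eq_add_neg, ← Finset.sum_neg_distrib]
    refine congrArg₂ _ (Finset.sum_congr rfl fun i hi => ?_) (Finset.sum_congr rfl fun i hi => ?_)
    · rw [← hleft ht hk i hi, Real.sign_of_pos (sub_pos.2 (hlt ht (Finset.mem_range.1 hi) hk)),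
        mul_one]
    · obtain ⟨h2, h3⟩ := Finset.mem_Ico.1 hi
      rw [← hright ht i (Finset.mem_Ico.2 ⟨by omega, h3⟩),
        Real.sign_of_neg (sub_neg.2 (hlt ht h2 h3))]
      ring

/-- The positions stay bounded: the last one from above, and by reflection the first one from
below. -/
theorem exists_exp_position_bounds (h : IsMultipeakon x m tc) (htc : 0 < tc)
    (hm : ∀ i, ∀ t ∈ Set.Ioo 0 tc, m i t ≠ 0) :
    ∃ c C, 0 < c ∧ ∀ k < N, ∀ᶠ t in 𝓝[<] tc,
      c ≤ Real.exp (extendByZero x k t) ∧ Real.exp (extendByZero x k t) ≤ C := by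
  cases N with
  | zero => exact ⟨1, 1, one_pos, fun k hk => absurd hk (Nat.not_lt_zero k)⟩
  | succ M =>
    have hy := h.isExpPeakon hm
    obtain ⟨C, hC⟩ := hy.exists_last_le htc
    obtain ⟨C', hC'⟩ := (h.reflect.isExpPeakon fun i t ht =>
      neg_ne_zero.2 (hm i.rev t ht)).exists_last_le htc
    have hrefl : ∀ t, extendByZero (fun i t => -x i.rev t) M t = -extendByZero x 0 t := by
      intro t
      have : (⟨M, Nat.lt_succ_self M⟩ : Fin (M + 1)).rev = 0 := Fin.rev_last M
      simp [extendByZero, this]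
    simp only [hrefl] at hC'
    have hC'0 : 0 < C' := by
      obtain ⟨t, ht⟩ := hC'.exists
      exact (Real.exp_pos _).trans_le ht
    refine ⟨C'⁻¹, C, inv_pos.2 hC'0, fun k hk => ?_⟩
    filter_upwards [eventually_mem_Ioo_left htc, hC, hC'] with t ht h1 h2
    refine ⟨le_trans ?_ (hy.le_of_le ht (Nat.zero_le k) hk),
      (hy.le_of_le ht (Nat.le_of_lt_succ hk) (Nat.lt_succ_self M)).trans h1⟩
    rw [Real.exp_neg] at h2
    exact inv_le_of_inv_le₀ (Real.exp_pos _) h2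

end IsMultipeakon

theorem not_blowsUpAt_of_tendsto {f : ℝ → ℝ} {tc a : ℝ} (h : Tendsto f (𝓝[<] tc) (𝓝 a)) :
    ¬ BlowsUpAt f tc := fun hf =>
  hf (|a| + 1) ((h.abs.eventually_le_const (lt_add_one _)).mono fun _ ht => ht.not_gt)

theorem RemainsBounded.not_blowsUpAt {f : ℝ → ℝ} {tc : ℝ} (htc : 0 < tc)
    (h : RemainsBounded f tc) : ¬ BlowsUpAt f tc := by
  obtain ⟨C, hC⟩ := h
  exact fun hf => hf C ((eventually_mem_Ioo_left htc).mono fun t ht =>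
    (hC t ⟨ht.1.le, ht.2⟩).not_gt)

/-- The theorem for systems in which all masses are nonzero. -/
theorem IsMultipeakon.blowUp_of_mass_ne_zero {N : ℕ} {x m : Fin N → ℝ → ℝ} {tc : ℝ}
    (htc : 0 < tc) (h : IsMultipeakon x m tc) (hm : ∀ i, ∀ t ∈ Set.Ioo 0 tc, m i t ≠ 0) {k : ℕ}
    {j : Fin k → Fin N} (hj : StrictMono j) (hblow : ∀ s, BlowsUpAt (m (j s)) tc)
    (hbdd : ∀ i, i ∉ Set.range j → ¬ BlowsUpAt (m i) tc) :
    Even k ∧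
    (∀ (l : ℕ) (hl : l + 1 < k), Even l → Collide x (j ⟨l, by omega⟩) (j ⟨l + 1, hl⟩) tc) ∧
    ∀ s : Fin k, HasLaurentLeadingTerm (m (j s)) tc ((-1) ^ ((s : ℕ) + 1) / 2) (-1) := by
  obtain ⟨c, C, hc, hcC⟩ := h.exists_exp_position_bounds htc hm
  obtain ⟨q, hq0, hqN, hcol, hmass⟩ := (h.isExpPeakon hm).exists_gap_orders htc hc hcC
  have hmass' : ∀ i : Fin N, (q i + q (i + 1) = 0 ∧ ∃ a, Tendsto (m i) (𝓝[<] tc) (𝓝 a)) ∨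
      (q i + q (i + 1) = 1 ∧
        HasLaurentLeadingTerm (m i) tc (((q i : ℝ) - q (i + 1)) / 2) (-1)) := by
    intro i
    simpa only [extendByZero_coe] using hmass i i.2
  have hlaurent : ∀ s, q (j s) + q (j s + 1) = 1 ∧
      HasLaurentLeadingTerm (m (j s)) tc (((q (j s) : ℝ) - q (j s + 1)) / 2) (-1) := by
    intro s
    rcases hmass' (j s) with ⟨-, a, ha⟩ | h1
    · exact absurd (hblow s) (not_blowsUpAt_of_tendsto ha)
    · exact h1
  obtain ⟨heven, hqs, hpair⟩ := pairing_of_gap_orders (j := fun s => (j s : ℕ)) hq0 hqN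
    (fun i hi => by rcases hmass' ⟨i, hi⟩ with h1 | h1 <;> exact h1.1.le.trans (by norm_num))
    hj (fun s => (j s).2) (fun i hi => by
      constructor
      · intro h1
        by_contra hne
        rcases hmass' ⟨i, hi⟩ with ⟨h2, -⟩ | ⟨-, h2⟩
        · simp only at h2
          omega
        · refine hbdd ⟨i, hi⟩ ?_ h2.blowsUpAt
          rintro ⟨s, hs⟩
          exact hne ⟨s, congrArg Fin.val hs⟩
      · rintro ⟨s, rfl⟩
        exact (hlaurent s).1)
  refine ⟨heven, fun l hl hle => ?_, fun s => ?_⟩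
  · have h1 := hpair l hl hle
    have h2 := (hqs ⟨l, by omega⟩).2
    have h3 : l % 2 = 0 := Nat.even_iff.1 hle
    simp only [h3] at h2
    have h4 : (j ⟨l, by omega⟩ : ℕ) + 1 < N := h1 ▸ (j ⟨l + 1, hl⟩).2
    obtain ⟨Y, hY, hl1, hl2⟩ := hcol _ h4 (by omega)
    rw [← h1] at hl2
    simp only [extendByZero_coe] at hl1 hl2
    exact ⟨Real.log Y, (hl1.log hY.ne').congr fun t => Real.log_exp _,
      (hl2.log hY.ne').congr fun t => Real.log_exp _⟩
  · obtain ⟨h1, h2⟩ := hqs s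
    convert (hlaurent s).2 using 1
    rw [h1, h2]
    rcases Nat.even_or_odd (s : ℕ) with hs | hs
    · rw [Nat.even_iff.1 hs, hs.add_one.neg_one_pow]
      norm_num
    · rw [Nat.odd_iff.1 hs, hs.add_one.neg_one_pow]
      norm_num

/-- The indices `j_1 < ⋯ < j_k` are `j 0 < ⋯ < j (k - 1)` here, so that odd `l` become even `l`
and the sign `(-1) ^ s` becomes `(-1) ^ (s + 1)`. -/
theorem mainTheorem2 {n : ℕ} (x m : Fin n → ℝ → ℝ) (tc : ℝ) (htc : 0 < tc)
    (hsol : IsMultipeakon x m tc)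
    (k : ℕ) (hk : 1 ≤ k) (j : Fin k → Fin n) (hj : StrictMono j)
    (hblow : ∀ s, BlowsUpAt (m (j s)) tc)
    (hbdd : ∀ i, i ∉ Set.range j → RemainsBounded (m i) tc) :
    Even k ∧
    (IsCollisionTime x tc ∧
      ∀ (l : ℕ) (hl : l + 1 < k), Even l →
        Collide x (j ⟨l, by omega⟩) (j ⟨l + 1, hl⟩) tc) ∧
    ∀ s : Fin k, HasLaurentLeadingTerm (m (j s)) tc ((-1) ^ ((s : ℕ) + 1) / 2) (-1) := by
  classical
  -- the wave function does not see peakons of zero mass; keep the others only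
  set S : Finset (Fin n) := Finset.univ.filter fun i => m i 0 ≠ 0
  set σ := S.orderEmbOfFin rfl
  have hrange : ∀ i, i ∈ Set.range σ ↔ m i 0 ≠ 0 := by
    intro i
    rw [Finset.range_orderEmbOfFin]
    simp [S]
  have hzero : ∀ i, i ∉ Set.range σ → ∀ t ∈ Set.Ioo 0 tc, m i t = 0 := fun i hi t ht =>
    (hsol.mass_eq_zero_iff i ⟨ht.1.le, ht.2⟩).2 (not_not.1 ((hrange i).not.1 hi))
  have hmem : ∀ s, j s ∈ Set.range σ := by
    intro s
    by_contra hs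
    refine not_blowsUpAt_of_tendsto (a := 0) (tendsto_const_nhds.congr' ?_) (hblow s)
    filter_upwards [eventually_mem_Ioo_left htc] with t ht
    exact (hzero _ hs t ht).symm
  choose j' hj' using hmem
  have hj'mono : StrictMono j' := fun s s' hs => by
    rw [← σ.lt_iff_lt, hj', hj']
    exact hj hs
  obtain ⟨heven, hcol, hlaurent⟩ :=
    (hsol.comp_of_eq_zero σ.strictMono hzero).blowUp_of_mass_ne_zero htc
      (fun i t ht => (hsol.mass_eq_zero_iff (σ i) ⟨ht.1.le, ht.2⟩).not.2 ((hrange _).1 ⟨i, rfl⟩))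
      hj'mono (fun s => by rw [hj']; exact hblow s)
      (fun i hi => (hbdd (σ i) (by
        rintro ⟨s, hs⟩
        exact hi ⟨s, σ.injective ((hj' s).trans hs)⟩)).not_blowsUpAt htc)
  have hcol' : ∀ (l : ℕ) (hl : l + 1 < k), Even l →
      Collide x (j ⟨l, by omega⟩) (j ⟨l + 1, hl⟩) tc := by
    intro l hl hle
    have h1 := hcol l hl hle
    rwa [Collide, hj', hj'] at h1
  refine ⟨heven, ⟨?_, hcol'⟩, fun s => by simpa only [hj'] using hlaurent s⟩
  have hk2 : 0 + 1 < k := by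
    obtain ⟨r, hr⟩ := heven
    omega
  obtain ⟨X, hX, hX'⟩ := hcol' 0 hk2 Even.zero
  have hlt : j ⟨0, by omega⟩ < j ⟨0 + 1, hk2⟩ := hj (Fin.lt_def.2 Nat.one_pos)
  have hi : (j ⟨0, by omega⟩ : ℕ) + 1 < n := lt_of_le_of_lt hlt (j ⟨0 + 1, hk2⟩).2
  -- a neighbour between two colliding peakons is squeezed
  refine ⟨j ⟨0, by omega⟩, hi, X, hX, tendsto_of_tendsto_of_tendsto_of_le_of_le' hX hX' ?_ ?_⟩ <;>
  · filter_upwards [eventually_mem_Ioo_left htc] with t ht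
    refine (hsol.strictMono_position ⟨ht.1.le, ht.2⟩).monotone (Fin.le_def.2 ?_)
    first
      | exact Nat.le_succ _
      | exact hlt
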